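/- Let $\eta(z)=q^{1/24}\prod_{n\ge 1}(1-q^n)$, $q=e^{2\pi i z}$, $\operatorname{Im} z>0$, be the Dedekind eta function, and let $a^*(n)$ and $c^*(n)$ be the Fourier coefficients defined by $$\eta^8(3z)=\sum_{n\ge 1}a^*(n)q^n,\qquad \eta^2(3z)\,\eta^2(9z)=\sum_{n\ge 1}c^*(n)q^n .$$ Let $p\equiv 1\pmod 3$ be a prime. Then $a^*(p)$ and $c^*(p)$ are integers and $$c^*(p)\mid a^*(p).$$ More precisely: 1. There are integers $x,y$ with $p=x^2+3y^2$ and $x\equiv 1\pmod 3$, and for all such $x,y$ one has $a^*(p)=2x^3-18xy^2$. 2. There are integers $m,n$ with $p=m^2+mn+n^2$, $m\equiv 1\pmod 3$ and $n\equiv 0\pmod 3$, and for all such $m,n$ one has $c^*(p)=2m+n$ and $a^*(p)=(2m+n)(m+2n)(m-n)$. -/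

import Mathlib

open UpperHalfPlane ModularForm

/-- `a*(n)`: the `n`-th coefficient of the Fourier expansion `∑ a*(n) q ^ n`, `q = exp (2 π i z)`,
of `η(3z) ^ 8`, where `η` is the Dedekind eta function. -/
noncomputable def aStar (n : ℕ) : ℂ :=
  (qExpansion 1 (fun z : ℍ => eta (3 * (z : ℂ)) ^ 8)).coeff n

/-- `c*(n)`: the `n`-th coefficient of the Fourier expansion `∑ c*(n) q ^ n`, `q = exp (2 π i z)`,
of `η(3z) ^ 2 η(9z) ^ 2`. -/
noncomputable def cStar (n : ℕ) : ℂ :=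
  (qExpansion 1 (fun z : ℍ => eta (3 * (z : ℂ)) ^ 2 * eta (9 * (z : ℂ)) ^ 2)).coeff n

open Filter Topology Finset

/-! Both eta products become sums over the lattice of Eisenstein integers, graded by the norm a² -
ab + b².

Write E(q) = ∏ (1 - q^n) and Θ(x) = ∑ (-1)^j q^(j(j-1)/2) x^j. The triple product gives Θ(1) = 0,
xΘ'(x) = -E(q)³ at x = 1, and Θ(w) = (1 - w) E(q³) for a primitive cube root of unity w. Multiply
three such series, indexed by i, j, k, with a weight g(a, b) in the differences a = i - k, b = j -
k. Summation along the diagonal leaves a pentagonal series, which is E(q) times a sign (zero when 3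
∣ a + b) and a power of Q, where q = Q³. Dividing by E(q) gives ∑ ±g(a, b) Q^(a² - ab + b²)
(`hasSum_eisNorm_of_triple`). The weight a²b produces η(3z)⁸, and a·w^b produces η(3z)²η(9z)².

For a prime p ≡ 1 mod 3 the elements of norm p are the twelve associates of one element and of its
conjugate (`eisNorm_eq_prime_iff`). The coefficients are then twelve-term sums: a*(p) = (a + b)(a -
2b)(2a - b), and c*(p) = 2a - b when a ≡ 1, b ≡ 0 mod 3. The divisibility is visible, and the stated
forms are linear substitutions. -/

lemma HasSum.of_eq {ι : Type*} {f g : ι → ℂ} {a b : ℂ} (h : HasSum f a) (hfg : ∀ i, g i = f i)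
    (hab : b = a) : HasSum g b := by
  rw [hab, funext hfg]
  exact h

lemma norm_pow_three_lt_one {q : ℂ} (hq : ‖q‖ < 1) : ‖q ^ 3‖ < 1 := by
  rw [norm_pow]; exact pow_lt_one₀ (norm_nonneg _) hq (by simp)

/-- The triangular numbers `j (j - 1) / 2`, indexed by all integers. -/
def tri (j : ℤ) : ℤ := j * (j - 1) / 2

lemma two_mul_tri (j : ℤ) : 2 * tri j = j * (j - 1) := by
  have h : (2 : ℤ) ∣ j * (j - 1) := by
    rcases Int.even_or_odd j with h | h
    · exact h.two_dvd.mul_right _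
    · exact (h.sub_odd odd_one).two_dvd.mul_left _
  exact Int.mul_ediv_cancel' h

lemma tri_sub_one (j : ℤ) : tri (j - 1) = tri j - (j - 1) := by
  have h₁ := two_mul_tri j
  have h₂ := two_mul_tri (j - 1)
  linarith

lemma tri_add_one (j : ℤ) : tri (j + 1) = tri j + j := by
  have h₁ := two_mul_tri j
  have h₂ := two_mul_tri (j + 1)
  linarith

lemma tri_one_sub (j : ℤ) : tri (1 - j) = tri j := by
  have h₁ := two_mul_tri j
  have h₂ := two_mul_tri (1 - j)
  linarith

/-! ### Finite Jacobi triple product -/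

/-- The Euler product `∏ (1 - q ^ n)` over `n ≥ 1`. -/
noncomputable def eulerProd (q : ℂ) : ℂ := ∏' n : ℕ, (1 - q ^ (n + 1))

/-- The finite product `(q; q)ₙ = ∏ (1 - q ^ k)` over `1 ≤ k ≤ n`. -/
noncomputable def qPoch (q : ℂ) (n : ℕ) : ℂ := ∏ k ∈ range n, (1 - q ^ (k + 1))

/-- The inverse of `(q; q)ₘ`, extended by zero to negative `m`. -/
noncomputable def invPoch (q : ℂ) : ℤ → ℂ
  | Int.ofNat n => (qPoch q n)⁻¹
  | Int.negSucc _ => 0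

lemma one_sub_pow_ne_zero {q : ℂ} (hq : ‖q‖ < 1) (n : ℕ) : 1 - q ^ (n + 1) ≠ 0 := by
  intro h
  have h' : ‖q ^ (n + 1)‖ < 1 := by
    rw [norm_pow]; exact pow_lt_one₀ (norm_nonneg _) hq (by simp)
  rw [← sub_eq_zero.mp h] at h'
  simp at h'

lemma qPoch_ne_zero {q : ℂ} (hq : ‖q‖ < 1) (n : ℕ) : qPoch q n ≠ 0 :=
  prod_ne_zero_iff.mpr fun k _ => one_sub_pow_ne_zero hq k

lemma qPoch_succ (q : ℂ) (n : ℕ) : qPoch q (n + 1) = qPoch q n * (1 - q ^ (n + 1)) :=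
  prod_range_succ _ _

lemma tendsto_qPoch {q : ℂ} (hq : ‖q‖ < 1) :
    Tendsto (qPoch q) atTop (𝓝 (eulerProd q)) :=
  (multipliable_one_sub_pow hq).tendsto_prod_tprod_nat

lemma eulerProd_ne_zero {q : ℂ} (hq : ‖q‖ < 1) : eulerProd q ≠ 0 := by
  refine tprod_one_add_ne_zero_of_summable (f := fun n : ℕ => -q ^ (n + 1)) ?_ ?_
  · exact fun i => by simpa [sub_eq_add_neg] using one_sub_pow_ne_zero hq i
  · simpa using (summable_nat_add_iff 1).mpr (summable_geometric_of_lt_one (norm_nonneg _) hq)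

lemma invPoch_sub_one {q : ℂ} (hq : ‖q‖ < 1) (m : ℤ) :
    invPoch q (m - 1) = (1 - q ^ m) * invPoch q m := by
  rcases m with (_ | n) | n
  · simp [invPoch]
    rfl
  · have : Int.ofNat (n + 1) - 1 = Int.ofNat n := by simp
    rw [this]
    simp only [invPoch, qPoch_succ, Int.ofNat_eq_natCast, zpow_natCast]
    field_simp [qPoch_ne_zero hq n, one_sub_pow_ne_zero hq n]
  · have : Int.negSucc n - 1 = Int.negSucc (n + 1) := by simp [Int.negSucc_eq]; ring
    rw [this]
    simp [invPoch]

/-- The coefficients of the finite form of the Jacobi triple product. -/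
noncomputable def tripleCoeff (q : ℂ) (n : ℕ) (j : ℤ) : ℂ :=
  (-1) ^ j * q ^ tri j * (qPoch q (2 * n) * invPoch q (n + j) * invPoch q (n - j))

/-- Up to a sign and a power of q, the coefficient is the Gaussian binomial of 2n over n + j. The
recursion encodes multiplication by (1 - x q^n)(1 - x⁻¹ q^(n+1)) = 1 + q^(2n+1) - q^n x - q^(n+1)
x⁻¹. -/
lemma tripleCoeff_succ {q : ℂ} (hq : ‖q‖ < 1) (h0 : q ≠ 0) (n : ℕ) (j : ℤ) :
    tripleCoeff q (n + 1) j = (1 + q ^ (2 * n + 1)) * tripleCoeff q n j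
      - q ^ n * tripleCoeff q n (j - 1) - q ^ (n + 1) * tripleCoeff q n (j + 1) := by
  have e₁ : invPoch q (n + j) = (1 - q ^ (n + 1 + j : ℤ)) * invPoch q (n + 1 + j) := by
    rw [← invPoch_sub_one hq]; congr 1; ring
  have e₂ : invPoch q (n - j) = (1 - q ^ (n + 1 - j : ℤ)) * invPoch q (n + 1 - j) := by
    rw [← invPoch_sub_one hq]; congr 1; ring
  have e₃ : invPoch q (n + (j - 1)) = (1 - q ^ (n + j : ℤ)) * invPoch q (n + j) := by
    rw [← invPoch_sub_one hq]; congr 1; ring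
  have e₄ : invPoch q (n - (j + 1)) = (1 - q ^ (n - j : ℤ)) * invPoch q (n - j) := by
    rw [← invPoch_sub_one hq]; congr 1; ring
  have e₅ : (n : ℤ) - (j - 1) = n + 1 - j := by ring
  have e₆ : (n : ℤ) + (j + 1) = n + 1 + j := by ring
  have e₇ : qPoch q (2 * (n + 1)) =
      qPoch q (2 * n) * (1 - q ^ (2 * n + 1)) * (1 - q ^ (2 * n + 2)) := by
    rw [mul_add, mul_one, qPoch_succ, qPoch_succ]
  have hy : q ^ j ≠ 0 := zpow_ne_zero _ h0
  have hm : (-1 : ℂ) ≠ 0 := by simp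
  simp only [tripleCoeff, e₃, e₄, e₅, e₆, e₇, e₁, e₂, tri_sub_one, tri_add_one, Nat.cast_add,
    Nat.cast_one]
  simp only [zpow_add₀ h0, zpow_sub₀ h0, zpow_add₀ hm, zpow_sub₀ hm, zpow_natCast, zpow_one,
    pow_add, pow_mul', pow_one]
  field_simp
  ring

lemma hasSum_tripleCoeff {q : ℂ} (hq : ‖q‖ < 1) (h0 : q ≠ 0) {x : ℂ} (hx : x ≠ 0) (n : ℕ) :
    HasSum (fun j : ℤ => tripleCoeff q n j * x ^ j)
      (∏ k ∈ range n, (1 - x * q ^ k) * (1 - x⁻¹ * q ^ (k + 1))) := by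
  induction n with
  | zero =>
    refine (hasSum_ite_eq (0 : ℤ) (1 : ℂ)).of_eq (fun j => ?_) (by simp)
    rcases j with (_ | j) | j
    · simp [tripleCoeff, invPoch, qPoch, tri]
    · have : -((j : ℤ) + 1) = Int.negSucc j := by simp [Int.negSucc_eq]
      have h' : ((j : ℤ) + 1) ≠ 0 := by omega
      simp [tripleCoeff, this, invPoch, h']
    · simp [tripleCoeff, invPoch]
  | succ n ih =>
    have h₁ := ih.mul_left (1 + q ^ (2 * n + 1))
    have h₂ := ((Equiv.subRight (1 : ℤ)).hasSum_iff.mpr ih).mul_left (q ^ n * x)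
    have h₃ := ((Equiv.addRight (1 : ℤ)).hasSum_iff.mpr ih).mul_left (q ^ (n + 1) * x⁻¹)
    refine ((h₁.sub h₂).sub h₃).of_eq (fun j => ?_) ?_
    · simp only [tripleCoeff_succ hq h0, Function.comp, Equiv.subRight_apply,
        Equiv.coe_addRight, zpow_sub₀ hx, zpow_add₀ hx, zpow_one]
      field_simp
    · rw [prod_range_succ]
      field_simp
      ring

/-- This is x·d/dx of the finite product at x = 1, computed by the product rule in `key`. The factor
1 - x at k = 0 kills the undifferentiated product, except when there are no factors; hence the index
n + 1. -/
lemma hasSum_mul_tripleCoeff {q : ℂ} (hq : ‖q‖ < 1) (h0 : q ≠ 0) (n : ℕ) :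
    HasSum (fun j : ℤ => tripleCoeff q (n + 1) j * j) (-(qPoch q n * qPoch q (n + 1))) := by
  have hF (m : ℕ) := hasSum_tripleCoeff hq h0 one_ne_zero m
  simp only [one_zpow, mul_one, one_mul, inv_one] at hF
  have key {m : ℕ} {D F : ℂ} (hD : HasSum (fun j : ℤ => tripleCoeff q m j * j) D)
      (hF : HasSum (fun j : ℤ => tripleCoeff q m j) F) :
      HasSum (fun j : ℤ => tripleCoeff q (m + 1) j * j)
        ((1 + q ^ (2 * m + 1)) * D - q ^ m * (D + F) - q ^ (m + 1) * (D - F)) := by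
    have h₁ := hD.mul_left (1 + q ^ (2 * m + 1))
    have h₂ := ((Equiv.subRight (1 : ℤ)).hasSum_iff.mpr (hD.add hF)).mul_left (q ^ m)
    have h₃ := ((Equiv.addRight (1 : ℤ)).hasSum_iff.mpr (hD.sub hF)).mul_left (q ^ (m + 1))
    refine ((h₁.sub h₂).sub h₃).of_eq (fun j => ?_) rfl
    simp only [tripleCoeff_succ hq h0, Function.comp, Equiv.subRight_apply, Equiv.coe_addRight]
    push_cast
    ring
  induction n with
  | zero =>
    have hD : HasSum (fun j : ℤ => tripleCoeff q 0 j * j) 0 := by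
      refine hasSum_zero.of_eq (fun j => ?_) rfl
      rcases j with (_ | j) | j
      · simp
      · have : -((j : ℤ) + 1) = Int.negSucc j := by simp [Int.negSucc_eq]
        simp [tripleCoeff, this, invPoch]
      · simp [tripleCoeff, invPoch]
    refine (key hD (hF 0)).of_eq (fun _ => rfl) ?_
    simp [qPoch]
    ring
  | succ n ih =>
    have h := key ih (hF (n + 1))
    rw [prod_range_succ' _ n] at h
    refine h.of_eq (fun _ => rfl) ?_
    simp only [qPoch_succ, pow_zero, sub_self, zero_mul, mul_zero]
    ring

/-! ### Theta series and their special values -/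

/-- The signed powers `(-1) ^ j q ^ (j (j - 1) / 2)`, the coefficients of the theta series. -/
noncomputable def thetaTerm (q : ℂ) (j : ℤ) : ℂ := (-1) ^ j * q ^ tri j

lemma summable_thetaTerm {q : ℂ} (hq : ‖q‖ < 1) (h0 : q ≠ 0) {x : ℂ} (hx : x ≠ 0) (k : ℕ) :
    Summable fun j : ℤ => ‖thetaTerm q j * ((j : ℂ) ^ k * x ^ j)‖ := by
  have hq0 : 0 < ‖q‖ := norm_pos_iff.mpr h0
  have hx0 : 0 < ‖x‖ := norm_pos_iff.mpr hx
  set L : ℝ := -Real.log ‖q‖ with hL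
  have hLpos : 0 < L := by
    have := Real.log_neg hq0 hq
    linarith
  set M : ℝ := Real.log ‖x‖ with hM
  have hπ := Real.pi_pos
  -- With |q| = e^(-L) and |x| = e^M, the term is at most |j|^k exp(-L j²/2 + (L/2 + |M|)|j|); the
  -- two constants put this in the shape of the Jacobi theta bound.
  refine Summable.of_nonneg_of_le (fun _ => norm_nonneg _) (fun j => ?_)
    (summable_pow_mul_jacobiTheta₂_term_bound ((L / 2 + |M|) / (2 * Real.pi))
      (T := L / (2 * Real.pi)) (by positivity) k)
  have h₁ : ‖q‖ ^ tri j = Real.exp (-L * tri j) := by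
    rw [← Real.rpow_intCast, Real.rpow_def_of_pos hq0, hL, neg_neg]
  have h₂ : ‖x‖ ^ j = Real.exp (M * j) := by
    rw [← Real.rpow_intCast, Real.rpow_def_of_pos hx0]
  have h₃ : (tri j : ℝ) = j * (j - 1) / 2 := by
    have := congrArg (Int.cast : ℤ → ℝ) (two_mul_tri j)
    push_cast at this
    linarith
  have h₄ : ‖(j : ℂ)‖ = |(j : ℝ)| := by simp
  simp only [thetaTerm, norm_mul, norm_zpow, norm_pow, norm_neg, norm_one, one_zpow, one_mul,
    h₁, h₂, h₃, h₄]
  rw [mul_left_comm, ← Real.exp_add]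
  push_cast
  gcongr
  have h₅ : M * j ≤ |M| * |(j : ℝ)| := (le_abs_self _).trans (abs_mul _ _).le
  have h₆ : L * j ≤ L * |(j : ℝ)| := by gcongr; exact le_abs_self _
  have h₇ : -Real.pi * (L / (2 * Real.pi) * (j : ℝ) ^ 2
      - 2 * ((L / 2 + |M|) / (2 * Real.pi)) * |(j : ℝ)|)
      = -(L * (j : ℝ) ^ 2 / 2) + (L / 2 + |M|) * |(j : ℝ)| := by
    field_simp
    ring
  rw [h₇]
  nlinarith

lemma exists_norm_qPoch_le {q : ℂ} (hq : ‖q‖ < 1) : ∃ C, ∀ n, ‖qPoch q n‖ ≤ C := by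
  obtain ⟨C, hC⟩ := (tendsto_qPoch hq).norm.bddAbove_range
  exact ⟨C, fun n => hC ⟨n, rfl⟩⟩

lemma exists_norm_invPoch_le {q : ℂ} (hq : ‖q‖ < 1) : ∃ C, ∀ m, ‖invPoch q m‖ ≤ C := by
  obtain ⟨C, hC⟩ := ((tendsto_qPoch hq).inv₀ (eulerProd_ne_zero hq)).norm.bddAbove_range
  have hC' (n : ℕ) : ‖(qPoch q n)⁻¹‖ ≤ C := hC ⟨n, rfl⟩
  refine ⟨C, fun m => ?_⟩
  rcases m with n | n
  · exact hC' n
  · simpa [invPoch] using (norm_nonneg _).trans (hC' 0)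

lemma tendsto_invPoch {q : ℂ} (hq : ‖q‖ < 1) :
    Tendsto (invPoch q) atTop (𝓝 (eulerProd q)⁻¹) := by
  rw [← Nat.map_cast_int_atTop, tendsto_map'_iff]
  exact (tendsto_qPoch hq).inv₀ (eulerProd_ne_zero hq)

/-- Dominated convergence: for fixed j the Gaussian binomial tends to E·E⁻¹·E⁻¹ = E⁻¹, and it is
bounded uniformly in n and j. -/
lemma tendsto_tsum_tripleCoeff_mul {q : ℂ} (hq : ‖q‖ < 1) {g : ℤ → ℂ}
    (hg : Summable fun j => ‖thetaTerm q j * g j‖) :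
    Tendsto (fun n => ∑' j, tripleCoeff q n j * g j) atTop
      (𝓝 ((eulerProd q)⁻¹ * ∑' j, thetaTerm q j * g j)) := by
  obtain ⟨C, hC⟩ := exists_norm_qPoch_le hq
  obtain ⟨D, hD⟩ := exists_norm_invPoch_le hq
  have hC0 : 0 ≤ C := (norm_nonneg _).trans (hC 0)
  have hD0 : 0 ≤ D := (norm_nonneg _).trans (hD 0)
  rw [← tsum_mul_left]
  refine tendsto_tsum_of_dominated_convergence (hg.mul_left (C * D * D)) (fun j => ?_)
    (Eventually.of_forall fun n j => ?_)
  · have hnat : Tendsto (fun n : ℕ => (n : ℤ)) atTop atTop := tendsto_natCast_atTop_atTop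
    have h₁ : Tendsto (fun n : ℕ => qPoch q (2 * n)) atTop (𝓝 (eulerProd q)) :=
      (tendsto_qPoch hq).comp (tendsto_id.const_mul_atTop' two_pos)
    have h₂ : Tendsto (fun n : ℕ => invPoch q (n + j)) atTop (𝓝 (eulerProd q)⁻¹) :=
      (tendsto_invPoch hq).comp (tendsto_atTop_add_const_right _ _ hnat)
    have h₃ : Tendsto (fun n : ℕ => invPoch q (n - j)) atTop (𝓝 (eulerProd q)⁻¹) :=
      (tendsto_invPoch hq).comp (tendsto_atTop_add_const_right _ (-j) hnat)
    have h := (((h₁.mul h₂).mul h₃).const_mul (thetaTerm q j)).mul_const (g j)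
    rw [mul_inv_cancel₀ (eulerProd_ne_zero hq), one_mul] at h
    convert h using 2
    · simp only [tripleCoeff, thetaTerm]
    · ring
  · have : tripleCoeff q n j * g j =
        (qPoch q (2 * n) * invPoch q (n + j) * invPoch q (n - j)) * (thetaTerm q j * g j) := by
      simp only [tripleCoeff, thetaTerm]
      ring
    rw [this, norm_mul, norm_mul, norm_mul]
    gcongr
    exacts [hC _, hD _, hD _]

/-- The **Jacobi triple product** identity. -/
theorem tendsto_tripleProduct {q : ℂ} (hq : ‖q‖ < 1) (h0 : q ≠ 0) {x : ℂ} (hx : x ≠ 0) :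
    Tendsto (fun n => ∏ k ∈ range n,
        (1 - q ^ (k + 1)) * ((1 - x * q ^ k) * (1 - x⁻¹ * q ^ (k + 1)))) atTop
      (𝓝 (∑' j : ℤ, thetaTerm q j * x ^ j)) := by
  have h := tendsto_tsum_tripleCoeff_mul hq (g := fun j => x ^ j)
    (by simpa using summable_thetaTerm hq h0 hx 0)
  simp only [fun n => (hasSum_tripleCoeff hq h0 hx n).tsum_eq] at h
  have h' := (tendsto_qPoch hq).mul h
  rw [mul_inv_cancel_left₀ (eulerProd_ne_zero hq)] at h'
  simpa only [prod_mul_distrib, qPoch] using h'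

/-- Jacobi's identity for the cube of the Euler product. -/
theorem tsum_thetaTerm_mul_self {q : ℂ} (hq : ‖q‖ < 1) (h0 : q ≠ 0) :
    ∑' j : ℤ, thetaTerm q j * j = -eulerProd q ^ 3 := by
  have h := tendsto_tsum_tripleCoeff_mul hq (g := fun j => (j : ℂ))
    (by simpa using summable_thetaTerm hq h0 one_ne_zero 1)
  replace h := h.comp (tendsto_add_atTop_nat 1)
  simp only [Function.comp_def, fun n => (hasSum_mul_tripleCoeff hq h0 n).tsum_eq] at h
  have h' := ((tendsto_qPoch hq).mul ((tendsto_qPoch hq).comp (tendsto_add_atTop_nat 1))).neg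
  have := tendsto_nhds_unique h h'
  field_simp [eulerProd_ne_zero hq] at this
  linear_combination this

lemma tsum_thetaTerm {q : ℂ} : ∑' j : ℤ, thetaTerm q j = 0 := by
  -- The involution j ↦ 1 - j preserves the exponent and flips the sign.
  have h : ∑' j : ℤ, thetaTerm q j = ∑' j : ℤ, -thetaTerm q j := by
    rw [← (Equiv.subLeft (1 : ℤ)).tsum_eq]
    refine tsum_congr fun j => ?_
    simp [thetaTerm, tri_one_sub, zpow_sub₀]
    rcases Int.even_or_odd j with h | h <;> simp [h.neg_one_zpow]
  rw [tsum_neg] at h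
  linear_combination h / 2

/-- The theta series at a primitive cube root of unity. -/
theorem tsum_thetaTerm_mul_zpow_cubeRoot {q : ℂ} (hq : ‖q‖ < 1) (h0 : q ≠ 0) {w : ℂ}
    (hw : w ^ 2 + w + 1 = 0) :
    ∑' j : ℤ, thetaTerm q j * w ^ j = (1 - w) * eulerProd (q ^ 3) := by
  have hw3 : w ^ 3 = 1 := by linear_combination (w - 1) * hw
  have hw0 : w ≠ 0 := by rintro rfl; simp at hw
  have hwi : w⁻¹ = w ^ 2 := by field_simp; exact hw3.symm
  have hq3 : ‖q ^ 3‖ < 1 := norm_pow_three_lt_one hq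
  -- An extra factor tending to 1 completes the shifted product, so that the partial products agree
  -- exactly with (1 - w)·(q³; q³)ₙ.
  have h₁ : Tendsto (fun n : ℕ => 1 - w * q ^ n) atTop (𝓝 (1 - w * 0)) :=
    ((tendsto_pow_atTop_nhds_zero_of_norm_lt_one hq).const_mul w).const_sub 1
  have h₂ := (tendsto_tripleProduct hq h0 hw0).mul h₁
  have h₃ := (tendsto_qPoch hq3).const_mul (1 - w)
  rw [mul_zero, sub_zero, mul_one] at h₂
  refine tendsto_nhds_unique h₂ (h₃.congr fun n => ?_)
  simp only [prod_mul_distrib]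
  have h₄ : (∏ k ∈ range n, (1 - w * q ^ k)) * (1 - w * q ^ n)
      = (∏ k ∈ range n, (1 - w * q ^ (k + 1))) * (1 - w) := by
    rw [← prod_range_succ, prod_range_succ']
    simp
  have h₅ : qPoch (q ^ 3) n = (∏ k ∈ range n, (1 - q ^ (k + 1))) *
      ((∏ k ∈ range n, (1 - w * q ^ (k + 1))) * ∏ k ∈ range n, (1 - w⁻¹ * q ^ (k + 1))) := by
    simp only [qPoch, ← prod_mul_distrib]
    refine prod_congr rfl fun k _ => ?_
    rw [hwi, ← pow_mul, mul_comm 3, pow_mul]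
    generalize q ^ (k + 1) = y
    linear_combination (y ^ 3 - y ^ 2) * hw3 + (y - y ^ 2) * hw
  rw [h₅]
  linear_combination -((∏ k ∈ range n, (1 - q ^ (k + 1))) *
    ∏ k ∈ range n, (1 - w⁻¹ * q ^ (k + 1))) * h₄

/-! ### Pentagonal series -/

/-- The series `∑ (-1) ^ k q ^ (3 k (k - 1) / 2 + s k)` of pentagonal type. -/
noncomputable def pentSeries (q : ℂ) (s : ℤ) : ℂ := ∑' k : ℤ, thetaTerm (q ^ 3) k * (q ^ s) ^ k

lemma pentSeries_zero (q : ℂ) : pentSeries q 0 = 0 := by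
  simp [pentSeries, tsum_thetaTerm]

/-- Grouping exponents by residue modulo 3 yields the triple product in q³ at x = q or x = q². -/
lemma qPoch_three_mul (q : ℂ) (n : ℕ) : qPoch q (3 * n) =
    ∏ k ∈ range n, (1 - (q ^ 3) ^ (k + 1)) * ((1 - q ^ (3 * k + 1)) * (1 - q ^ (3 * k + 2))) := by
  induction n with
  | zero => simp [qPoch]
  | succ n ih =>
    rw [prod_range_succ, ← ih, mul_add, mul_one, qPoch_succ, qPoch_succ, qPoch_succ, ← pow_mul]
    ring

/-- Euler's pentagonal number theorem. -/
lemma pentSeries_one {q : ℂ} (hq : ‖q‖ < 1) (h0 : q ≠ 0) : pentSeries q 1 = eulerProd q := by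
  have hq3 : ‖q ^ 3‖ < 1 := norm_pow_three_lt_one hq
  rw [pentSeries, zpow_one]
  refine tendsto_nhds_unique (tendsto_tripleProduct hq3 (pow_ne_zero 3 h0) h0)
    (((tendsto_qPoch hq).comp (tendsto_id.const_mul_atTop' three_pos)).congr fun n => ?_)
  simp only [Function.comp, id, qPoch_three_mul]
  refine prod_congr rfl fun k _ => ?_
  congr 2
  · ring
  · congr 1
    field_simp
    ring

lemma pentSeries_two {q : ℂ} (hq : ‖q‖ < 1) (h0 : q ≠ 0) : pentSeries q 2 = eulerProd q := by
  have hq3 : ‖q ^ 3‖ < 1 := norm_pow_three_lt_one hq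
  rw [pentSeries, show (2 : ℤ) = ((2 : ℕ) : ℤ) by rfl, zpow_natCast]
  refine tendsto_nhds_unique
    (tendsto_tripleProduct hq3 (pow_ne_zero 3 h0) (pow_ne_zero 2 h0))
    (((tendsto_qPoch hq).comp (tendsto_id.const_mul_atTop' three_pos)).congr fun n => ?_)
  simp only [Function.comp, id, qPoch_three_mul]
  refine prod_congr rfl fun k _ => ?_
  rw [mul_comm (1 - q ^ (3 * k + 1))]
  congr 2
  · ring
  · congr 1
    field_simp
    ring

lemma pentSeries_add_three {q : ℂ} (h0 : q ≠ 0) (s : ℤ) :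
    pentSeries q (s + 3) = -(q ^ s)⁻¹ * pentSeries q s := by
  rw [pentSeries, pentSeries, ← tsum_mul_left, ← (Equiv.subRight (1 : ℤ)).tsum_eq]
  refine tsum_congr fun k => ?_
  have hm : (-1 : ℂ) ≠ 0 := by simp
  have hs : q ^ s ≠ 0 := zpow_ne_zero _ h0
  have h3 : q ^ (3 : ℤ) ≠ 0 := zpow_ne_zero _ h0
  have hk : (q ^ (3 : ℤ)) ^ k ≠ 0 := zpow_ne_zero _ h3
  simp only [Equiv.subRight_apply, thetaTerm, tri_sub_one, zpow_sub₀ hm, zpow_add₀ h0,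
    mul_zpow, zpow_sub₀ hs, zpow_sub₀ h3, ← zpow_natCast, Nat.cast_ofNat, zpow_one]
  field_simp

/-- The sign `0, -1, 1` of an integer congruent to `0, 1, 2` modulo `3`. -/
def signThree (s : ℤ) : ℤ := if s % 3 = 1 then -1 else if s % 3 = 2 then 1 else 0

lemma signThree_add_three (s : ℤ) : signThree (s + 3) = signThree s := by
  simp [signThree]

/-- The norm form `a² - ab + b²` of the Eisenstein integers. -/
def eisNorm (v : ℤ × ℤ) : ℤ := v.1 ^ 2 - v.1 * v.2 + v.2 ^ 2

lemma eisNorm_nonneg (v : ℤ × ℤ) : 0 ≤ eisNorm v := by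
  simp only [eisNorm]
  nlinarith [sq_nonneg (v.1 - v.2), sq_nonneg v.1, sq_nonneg v.2]

lemma eisNorm_eq (a b : ℤ) :
    eisNorm (a, b) = 3 * (tri a + tri b) - tri (a + b - 1) + 1 := by
  have h₁ := two_mul_tri a
  have h₂ := two_mul_tri b
  have h₃ := two_mul_tri (a + b - 1)
  simp only [eisNorm]
  linarith

/-- The shift by 3 reduces s to 0, 1, 2. Working with q = Q³ allows one exponent `tri (s - 1)` for
every s. -/
lemma pentSeries_eq {Q : ℂ} (hQ : ‖Q‖ < 1) (h0 : Q ≠ 0) (s : ℤ) :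
    pentSeries (Q ^ 3) s =
      eulerProd (Q ^ 3) * ((-1) ^ s * signThree s * (Q ^ tri (s - 1))⁻¹) := by
  have hq : ‖Q ^ 3‖ < 1 := norm_pow_three_lt_one hQ
  have hq0 : Q ^ 3 ≠ 0 := pow_ne_zero 3 h0
  have hm : (-1 : ℂ) ≠ 0 := by simp
  -- An equivalence, because the induction on the quotient of s by 3 runs in both directions.
  have hstep (s : ℤ) : pentSeries (Q ^ 3) (s + 3) =
        eulerProd (Q ^ 3) * ((-1) ^ (s + 3) * signThree (s + 3) * (Q ^ tri (s + 3 - 1))⁻¹) ↔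
      pentSeries (Q ^ 3) s =
        eulerProd (Q ^ 3) * ((-1) ^ s * signThree s * (Q ^ tri (s - 1))⁻¹) := by
    have ht : tri (s + 3 - 1) = tri (s - 1) + 3 * s := by
      have h₁ := two_mul_tri (s + 3 - 1)
      have h₂ := two_mul_tri (s - 1)
      linarith
    have hQs : (Q ^ 3) ^ s ≠ 0 := zpow_ne_zero _ hq0
    have hQs' : Q ^ (3 * s) = (Q ^ 3) ^ s := by
      rw [zpow_mul]; norm_cast
    have he : eulerProd (Q ^ 3) * ((-1) ^ (s + 3) * signThree (s + 3) * (Q ^ tri (s + 3 - 1))⁻¹) =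
        -((Q ^ 3) ^ s)⁻¹ *
          (eulerProd (Q ^ 3) * ((-1) ^ s * signThree s * (Q ^ tri (s - 1))⁻¹)) := by
      rw [signThree_add_three, ht, zpow_add₀ h0, zpow_add₀ hm, hQs', mul_inv,
        show (-1 : ℂ) ^ (3 : ℤ) = -1 by norm_num]
      ring
    rw [pentSeries_add_three hq0, he, mul_right_inj' (neg_ne_zero.mpr (inv_ne_zero hQs))]
  have hbase (r : ℤ) (h : pentSeries (Q ^ 3) r =
        eulerProd (Q ^ 3) * ((-1) ^ r * signThree r * (Q ^ tri (r - 1))⁻¹)) (t : ℤ) :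
      pentSeries (Q ^ 3) (r + 3 * t) = eulerProd (Q ^ 3) *
        ((-1) ^ (r + 3 * t) * signThree (r + 3 * t) * (Q ^ tri (r + 3 * t - 1))⁻¹) := by
    induction t with
    | zero => simpa using h
    | succ t ih => rw [show r + 3 * ((t : ℤ) + 1) = r + 3 * t + 3 by ring]; exact (hstep _).mpr ih
    | pred t ih =>
      rw [show r + 3 * (-(t : ℤ)) = r + 3 * (-t - 1) + 3 by ring] at ih
      exact (hstep _).mp ih
  have hs := Int.emod_add_mul_ediv s 3
  have hlt := Int.emod_lt_of_pos s (by norm_num : (0 : ℤ) < 3)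
  have hnn := Int.emod_nonneg s (by norm_num : (3 : ℤ) ≠ 0)
  rw [← hs]
  generalize s % 3 = r at *
  generalize s / 3 = t at *
  clear hs
  apply hbase
  interval_cases r
  · simp [pentSeries_zero, signThree]
  · rw [pentSeries_one hq hq0]
    simp [signThree, tri]
  · rw [pentSeries_two hq hq0]
    simp [signThree, tri]

/-! ### Products of three theta series -/

/-- The shear `(i, j, k) ↦ (i + k, j + k, k)` of `ℤ³`. -/
def shear : (ℤ × ℤ) × ℤ ≃ (ℤ × ℤ) × ℤ where
  toFun v := ((v.1.1 + v.2, v.1.2 + v.2), v.2)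
  invFun v := ((v.1.1 - v.2, v.1.2 - v.2), v.2)
  left_inv v := by simp
  right_inv v := by simp

/-- On a diagonal the three exponents add up to 3·`tri k` + (a + b)k plus a constant, so the sum
over k is `pentSeries q (a + b)`. -/
lemma thetaTerm_shear {q : ℂ} (h0 : q ≠ 0) (a b k : ℤ) :
    thetaTerm q (a + k) * thetaTerm q (b + k) * thetaTerm q k =
      (-1) ^ (a + b) * q ^ (tri a + tri b) * (thetaTerm (q ^ 3) k * (q ^ (a + b)) ^ k) := by
  have ht : tri (a + k) + tri (b + k) + tri k = tri a + tri b + 3 * tri k + (a + b) * k := by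
    have h₁ := two_mul_tri (a + k)
    have h₂ := two_mul_tri (b + k)
    have h₃ := two_mul_tri a
    have h₄ := two_mul_tri b
    have h₅ := two_mul_tri k
    linarith
  have hm : (-1 : ℂ) ≠ 0 := by simp
  have hk : ((-1 : ℂ) ^ k) ^ 2 = 1 := by
    rw [← zpow_natCast, ← zpow_mul, mul_comm, zpow_mul]; simp
  have hq : (q ^ 3) ^ tri k = q ^ (3 * tri k) := by
    rw [zpow_mul]; norm_cast
  calc _ = (-1) ^ (a + k) * (-1) ^ (b + k) * (-1) ^ k * q ^ (tri (a + k) + tri (b + k) + tri k) := by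
        simp only [thetaTerm, zpow_add₀ h0]; ring
    _ = _ := by
        rw [ht, thetaTerm, hq, ← zpow_mul]
        simp only [zpow_add₀ h0, zpow_add₀ hm]
        linear_combination (-1) ^ a * (-1) ^ b * (-1) ^ k * (q ^ tri a * q ^ tri b *
          q ^ (3 * tri k) * q ^ ((a + b) * k)) * hk

lemma hasSum_mul_triple {ι : Type*} {f g h : ι → ℂ} (hf : Summable fun i => ‖f i‖)
    (hg : Summable fun i => ‖g i‖) (hh : Summable fun i => ‖h i‖) :
    HasSum (fun x : (ι × ι) × ι => f x.1.1 * g x.1.2 * h x.2)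
      ((∑' i, f i) * (∑' i, g i) * ∑' i, h i) := by
  have h₁ : HasSum (fun x : ι × ι => f x.1 * g x.2) ((∑' i, f i) * ∑' i, g i) :=
    hf.of_norm.hasSum.mul hg.of_norm.hasSum (summable_mul_of_summable_norm hf hg)
  have h₂ : Summable fun x : ι × ι => ‖f x.1 * g x.2‖ := hf.mul_norm hg
  exact h₁.mul hh.of_norm.hasSum
    (summable_mul_of_summable_norm (f := fun x : ι × ι => f x.1 * g x.2) h₂ hh)

lemma hasSum_thetaTerm_triple {q : ℂ} {u v w : ℤ → ℂ}
    (hu : Summable fun j => ‖thetaTerm q j * u j‖) (hv : Summable fun j => ‖thetaTerm q j * v j‖)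
    (hw : Summable fun j => ‖thetaTerm q j * w j‖) :
    HasSum (fun x : (ℤ × ℤ) × ℤ => thetaTerm q x.1.1 * thetaTerm q x.1.2 * thetaTerm q x.2 *
        (u x.1.1 * v x.1.2 * w x.2))
      ((∑' j, thetaTerm q j * u j) * (∑' j, thetaTerm q j * v j) *
        ∑' j, thetaTerm q j * w j) :=
  (hasSum_mul_triple hu hv hw).of_eq (fun x => by ring) rfl

/-- Summation of a function on `ℤ³` that is invariant under diagonal translation against the
product of three theta series. -/
lemma hasSum_eisNorm_of_triple {Q : ℂ} (hQ : ‖Q‖ < 1) (h0 : Q ≠ 0) {g : ℤ → ℤ → ℂ} {S : ℂ}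
    (h : HasSum (fun x : (ℤ × ℤ) × ℤ => thetaTerm (Q ^ 3) x.1.1 * thetaTerm (Q ^ 3) x.1.2 *
      thetaTerm (Q ^ 3) x.2 * g (x.1.1 - x.2) (x.1.2 - x.2)) S) :
    HasSum (fun v : ℤ × ℤ => (signThree (v.1 + v.2) : ℂ) * g v.1 v.2 * Q ^ eisNorm v)
      (Q * (eulerProd (Q ^ 3))⁻¹ * S) := by
  have hq := norm_pow_three_lt_one hQ
  have hq0 : Q ^ 3 ≠ 0 := pow_ne_zero 3 h0
  have hP := eulerProd_ne_zero hq
  have h₁ := shear.hasSum_iff.mpr h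
  have h₂ (v : ℤ × ℤ) : HasSum (fun k : ℤ => (-1) ^ (v.1 + v.2) * (Q ^ 3) ^ (tri v.1 + tri v.2) *
      g v.1 v.2 * (thetaTerm ((Q ^ 3) ^ 3) k * ((Q ^ 3) ^ (v.1 + v.2)) ^ k))
      ((-1) ^ (v.1 + v.2) * (Q ^ 3) ^ (tri v.1 + tri v.2) * g v.1 v.2 *
        pentSeries (Q ^ 3) (v.1 + v.2)) := by
    refine HasSum.mul_left _ (Summable.hasSum (Summable.of_norm ?_))
    simpa using summable_thetaTerm (norm_pow_three_lt_one hq) (pow_ne_zero 3 hq0)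
      (zpow_ne_zero (v.1 + v.2) hq0) 0
  have h₃ := (h₁.of_eq (g := fun x : (ℤ × ℤ) × ℤ => (-1) ^ (x.1.1 + x.1.2) *
      (Q ^ 3) ^ (tri x.1.1 + tri x.1.2) * g x.1.1 x.1.2 *
      (thetaTerm ((Q ^ 3) ^ 3) x.2 * ((Q ^ 3) ^ (x.1.1 + x.1.2)) ^ x.2)) (fun x => by
        simp only [shear, Function.comp, Equiv.coe_fn_mk, add_sub_cancel_right,
          thetaTerm_shear hq0]
        ring) rfl).prod_fiberwise h₂
  refine (h₃.mul_left (Q * (eulerProd (Q ^ 3))⁻¹)).of_eq (fun v => ?_) rfl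
  have hs : ((-1 : ℂ) ^ (v.1 + v.2)) ^ 2 = 1 := by
    rw [← zpow_natCast, ← zpow_mul, mul_comm, zpow_mul]; simp
  have hN : Q ^ eisNorm v =
      (Q ^ 3) ^ (tri v.1 + tri v.2) * (Q ^ tri (v.1 + v.2 - 1))⁻¹ * Q := by
    rw [← Prod.mk.eta (p := v), eisNorm_eq, zpow_add₀ h0, zpow_sub₀ h0, zpow_mul, zpow_one]
    rfl
  rw [pentSeries_eq hQ h0, hN]
  field_simp
  linear_combination -(signThree (v.1 + v.2) : ℂ) * g v.1 v.2 * hs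

theorem hasSum_eulerProd_pow_eight {Q : ℂ} (hQ : ‖Q‖ < 1) (h0 : Q ≠ 0) :
    HasSum (fun v : ℤ × ℤ => (signThree (v.1 + v.2) : ℂ) * ((v.1 : ℂ) ^ 2 * v.2) * Q ^ eisNorm v)
      (2 * (Q * eulerProd (Q ^ 3) ^ 8)) := by
  have hq := norm_pow_three_lt_one hQ
  have hq0 : Q ^ 3 ≠ 0 := pow_ne_zero 3 h0
  have hs (k : ℕ) : Summable fun j : ℤ => ‖thetaTerm (Q ^ 3) j * (j : ℂ) ^ k‖ := by
    simpa using summable_thetaTerm hq hq0 one_ne_zero k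
  have H (k l m : ℕ) := hasSum_thetaTerm_triple (hs k) (hs l) (hs m)
  have h₀ : ∑' j : ℤ, thetaTerm (Q ^ 3) j * (j : ℂ) ^ 0 = 0 := by simp [tsum_thetaTerm]
  have h₁ : ∑' j : ℤ, thetaTerm (Q ^ 3) j * (j : ℂ) ^ 1 = -eulerProd (Q ^ 3) ^ 3 := by
    simpa using tsum_thetaTerm_mul_self hq hq0
  -- The expansion of (i - k)²(j - k). Any monomial missing a variable contains the factor Θ(1) = 0;
  -- only -2ijk survives and gives 2E⁹.
  have h := ((((H 2 1 0).sub (H 2 0 1)).sub ((H 1 1 1).mul_left 2)).add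
    (((H 1 0 2).mul_left 2).add (H 0 1 2))).sub (H 0 0 3)
  simp only [h₀, h₁] at h
  have h' := hasSum_eisNorm_of_triple hQ h0 (g := fun a b => (a : ℂ) ^ 2 * b)
    (S := 2 * eulerProd (Q ^ 3) ^ 9) (h.of_eq (fun x => by push_cast; ring) (by ring))
  refine h'.of_eq (fun _ => rfl) ?_
  field_simp [eulerProd_ne_zero hq]

theorem hasSum_eulerProd_sq_mul_sq {Q : ℂ} (hQ : ‖Q‖ < 1) (h0 : Q ≠ 0) {w : ℂ}
    (hw : w ^ 2 + w + 1 = 0) :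
    HasSum (fun v : ℤ × ℤ => (signThree (v.1 + v.2) : ℂ) * (v.1 * w ^ v.2) * Q ^ eisNorm v)
      (-3 * (Q * (eulerProd (Q ^ 3) ^ 2 * eulerProd (Q ^ 9) ^ 2))) := by
  have hq := norm_pow_three_lt_one hQ
  have hq0 : Q ^ 3 ≠ 0 := pow_ne_zero 3 h0
  have hw0 : w ≠ 0 := by rintro rfl; simp at hw
  have hw3 : w ^ 3 = 1 := by linear_combination (w - 1) * hw
  have hwi : w⁻¹ = w ^ 2 := by field_simp; exact hw3.symm
  have hw' : w⁻¹ ^ 2 + w⁻¹ + 1 = 0 := by rw [hwi]; linear_combination w * hw3 + hw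
  have h9 : (Q ^ 3) ^ 3 = Q ^ 9 := by ring
  have hs {x : ℂ} (hx : x ≠ 0) (k : ℕ) :
      Summable fun j : ℤ => ‖thetaTerm (Q ^ 3) j * ((j : ℂ) ^ k * x ^ j)‖ :=
    summable_thetaTerm hq hq0 hx k
  have h₀ : ∑' j : ℤ, thetaTerm (Q ^ 3) j * ((j : ℂ) ^ 0 * 1 ^ j) = 0 := by simp [tsum_thetaTerm]
  have h₁ : ∑' j : ℤ, thetaTerm (Q ^ 3) j * ((j : ℂ) ^ 1 * 1 ^ j) = -eulerProd (Q ^ 3) ^ 3 := by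
    simpa using tsum_thetaTerm_mul_self hq hq0
  have h₂ {x : ℂ} (hx : x ^ 2 + x + 1 = 0) :
      ∑' j : ℤ, thetaTerm (Q ^ 3) j * ((j : ℂ) ^ 0 * x ^ j) = (1 - x) * eulerProd (Q ^ 9) := by
    simpa [h9] using tsum_thetaTerm_mul_zpow_cubeRoot hq hq0 hx
  -- Here (i - k) w^(j - k) is split at the minus sign. The part with k vanishes since i carries
  -- Θ(1) = 0; the other uses (1 - w)(1 - w⁻¹) = 3.
  have h := (hasSum_thetaTerm_triple (hs one_ne_zero 1) (hs hw0 0) (hs (inv_ne_zero hw0) 0)).sub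
    (hasSum_thetaTerm_triple (hs one_ne_zero 0) (hs hw0 0) (hs (inv_ne_zero hw0) 1))
  rw [h₀, h₁, h₂ hw, h₂ hw'] at h
  have h' := hasSum_eisNorm_of_triple hQ h0 (g := fun a b => (a : ℂ) * w ^ b)
    (S := -3 * (eulerProd (Q ^ 3) ^ 3 * eulerProd (Q ^ 9) ^ 2)) (h.of_eq (fun x => by
      simp only [one_zpow, inv_zpow', zpow_sub₀ hw0, zpow_neg]
      push_cast
      field_simp) (by
      rw [hwi]
      linear_combination (eulerProd (Q ^ 3) ^ 3 * eulerProd (Q ^ 9) ^ 2) * (hw3 - hw)))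
  refine h'.of_eq (fun _ => rfl) ?_
  field_simp [eulerProd_ne_zero hq]

/-! ### Eisenstein integers of prime norm -/

lemma eisNorm_eq_one {x y : ℤ} (h : x ^ 2 - x * y + y ^ 2 = 1) :
    (x = 1 ∧ y = 0) ∨ (x = -1 ∧ y = 0) ∨ (x = 0 ∧ y = 1) ∨ (x = 0 ∧ y = -1) ∨
      (x = 1 ∧ y = 1) ∨ (x = -1 ∧ y = -1) := by
  have hx₁ : x ≤ 1 := by nlinarith [sq_nonneg (x - 2 * y)]
  have hx₂ : -1 ≤ x := by nlinarith [sq_nonneg (x - 2 * y)]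
  have hy₁ : y ≤ 1 := by nlinarith [sq_nonneg (y - 2 * x)]
  have hy₂ : -1 ≤ y := by nlinarith [sq_nonneg (y - 2 * x)]
  interval_cases x <;> interval_cases y <;> simp_all

/-- The twelve associates of an Eisenstein integer `a + bω` and of its conjugate. -/
def eisAssociates (a b : ℤ) : List (ℤ × ℤ) :=
  [(a, b), (-b, a - b), (b - a, -a), (a - b, -b), (-a, b - a), (b, a),
    (-a, -b), (b, b - a), (a - b, a), (b - a, b), (a, a - b), (-b, -a)]

lemma mem_eisAssociates_of_dvd {p a b c d : ℤ} (hp : Prime p)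
    (hab : a ^ 2 - a * b + b ^ 2 = p) (hcd : c ^ 2 - c * d + d ^ 2 = p)
    (h : p ∣ a * d - b * c) :
    (c = a ∧ d = b) ∨ (c = -a ∧ d = -b) ∨ (c = -b ∧ d = a - b) ∨ (c = b ∧ d = b - a) ∨
      (c = a - b ∧ d = a) ∨ (c = b - a ∧ d = -a) := by
  have hp0 := hp.ne_zero
  -- The norm of (c + dω) times the conjugate of a + bω, whose coordinates are c(a - b) + bd and ad
  -- - bc. Both turn out divisible by p, and the quotient is a unit X + Yω.
  have hN : (c * (a - b) + b * d) ^ 2 - (c * (a - b) + b * d) * (a * d - b * c) +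
      (a * d - b * c) ^ 2 = p * p := by
    rw [← hab]
    linear_combination (a ^ 2 - a * b + b ^ 2) * hcd + (a ^ 2 - a * b + b ^ 2) * hab.symm
  obtain ⟨Y, hY⟩ := h
  rw [hY] at hN
  have hX : p ∣ c * (a - b) + b * d := by
    refine hp.dvd_of_dvd_pow (n := 2) ⟨p + (c * (a - b) + b * d) * Y - p * Y ^ 2, ?_⟩
    linear_combination hN
  obtain ⟨X, hX⟩ := hX
  rw [hX] at hN
  have h1 : X ^ 2 - X * Y + Y ^ 2 = 1 := by
    apply mul_left_cancel₀ (mul_ne_zero hp0 hp0)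
    linear_combination hN
  have hc : c = X * a - Y * b := by
    apply mul_left_cancel₀ hp0
    linear_combination a * hX - b * hY - c * hab
  have hd : d = X * b + Y * a - Y * b := by
    apply mul_left_cancel₀ hp0
    linear_combination b * hX + (a - b) * hY - d * hab
  rcases eisNorm_eq_one h1 with ⟨rfl, rfl⟩ | ⟨rfl, rfl⟩ | ⟨rfl, rfl⟩ | ⟨rfl, rfl⟩ | ⟨rfl, rfl⟩ |
    ⟨rfl, rfl⟩ <;> omega

lemma eisNorm_eq_prime_iff {p a b : ℤ} (hp : Prime p) (hab : eisNorm (a, b) = p) (v : ℤ × ℤ) :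
    eisNorm v = p ↔ v ∈ eisAssociates a b := by
  obtain ⟨c, d⟩ := v
  simp only [eisNorm] at hab ⊢
  constructor
  · intro hcd
    -- The second factor is the same determinant for the conjugate (a - b, -b).
    have hdvd : p ∣ (a * d - b * c) * ((a - b) * d + b * c) := by
      refine ⟨d ^ 2 - b ^ 2, ?_⟩
      linear_combination d ^ 2 * hab - b ^ 2 * hcd
    simp only [eisAssociates, List.mem_cons, Prod.mk.injEq, List.not_mem_nil, or_false]
    rcases hp.dvd_or_dvd hdvd with h | h
    · rcases mem_eisAssociates_of_dvd hp hab hcd h with ⟨rfl, rfl⟩ | ⟨rfl, rfl⟩ | ⟨rfl, rfl⟩ |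
        ⟨rfl, rfl⟩ | ⟨rfl, rfl⟩ | ⟨rfl, rfl⟩ <;> simp
    · rcases mem_eisAssociates_of_dvd (a := a - b) (b := -b) hp (by linear_combination hab) hcd
        (by rwa [neg_mul, sub_neg_eq_add]) with ⟨rfl, rfl⟩ | ⟨rfl, rfl⟩ | ⟨rfl, rfl⟩ |
        ⟨rfl, rfl⟩ | ⟨rfl, rfl⟩ | ⟨rfl, rfl⟩ <;> (try ring_nf) <;> simp
  · intro h
    simp only [eisAssociates, List.mem_cons, Prod.mk.injEq, List.not_mem_nil, or_false] at h
    rcases h with ⟨rfl, rfl⟩ | ⟨rfl, rfl⟩ | ⟨rfl, rfl⟩ | ⟨rfl, rfl⟩ | ⟨rfl, rfl⟩ | ⟨rfl, rfl⟩ |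
      ⟨rfl, rfl⟩ | ⟨rfl, rfl⟩ | ⟨rfl, rfl⟩ | ⟨rfl, rfl⟩ | ⟨rfl, rfl⟩ | ⟨rfl, rfl⟩ <;>
      linear_combination hab

lemma nodup_eisAssociates {p a b : ℤ} (hp : Prime p) (hab : eisNorm (a, b) = p)
    (hs : (a + b) % 3 = 1) : (eisAssociates a b).Nodup := by
  simp only [eisNorm] at hab
  have hsq (x : ℤ) : p ≠ x ^ 2 := fun h => by
    have := hp.irreducible
    rw [h] at this
    exact not_irreducible_pow (by norm_num) this
  have ha : a ≠ 0 := by rintro rfl; exact hsq b (by linear_combination -hab)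
  have hb : b ≠ 0 := by rintro rfl; exact hsq a (by linear_combination -hab)
  have hne : a ≠ b := by rintro rfl; exact hsq a (by linear_combination -hab)
  simp only [eisAssociates, List.nodup_cons, List.mem_cons, Prod.mk.injEq, List.not_mem_nil,
    or_false, not_or, List.nodup_nil, not_false_eq_true, and_true]
  and_intros <;> omega

lemma tsum_eisNorm_fiber {p a b : ℤ} (hp : Prime p) (hab : eisNorm (a, b) = p)
    (hs : (a + b) % 3 = 1) (F : ℤ × ℤ → ℂ) :
    ∑' v : {v // eisNorm v = p}, F v = ((eisAssociates a b).map F).sum := by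
  rw [← List.sum_toFinset F (nodup_eisAssociates hp hab hs),
    ← Finset.tsum_subtype]
  refine (Equiv.subtypeEquivRight fun v => ?_).tsum_eq
    (fun v : {v // v ∈ (eisAssociates a b).toFinset} => F v)
  rw [eisNorm_eq_prime_iff hp hab, List.mem_toFinset]

/-- Thue's argument: with r a primitive cube root of unity mod p, the pigeonhole principle gives a
small nonzero (u, v) with u ≡ -rv, whose norm is a multiple of p below 3p. -/
lemma exists_eisNorm_eq {p : ℕ} (hp : p.Prime) (hp3 : p % 3 = 1) :
    ∃ a b : ℤ, eisNorm (a, b) = p ∧ (a + b) % 3 = 1 := by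
  have := Fact.mk hp
  obtain ⟨r, hr⟩ : ∃ r : ZMod p, r ^ 2 + r + 1 = 0 := by
    have := Fact.mk Nat.prime_three
    obtain ⟨u, hu⟩ := exists_prime_orderOf_dvd_card (G := (ZMod p)ˣ) 3 (by
      rw [ZMod.card_units p]
      omega)
    refine ⟨u, ?_⟩
    have hu3 : (u : ZMod p) ^ 3 = 1 := by
      rw [← Units.val_pow_eq_pow_val, ← hu, pow_orderOf_eq_one, Units.val_one]
    have hu1 : (u : ZMod p) - 1 ≠ 0 := by
      intro h
      rw [sub_eq_zero, Units.val_eq_one] at h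
      rw [h, orderOf_one] at hu
      norm_num at hu
    apply mul_left_cancel₀ hu1
    linear_combination hu3
  set k := Nat.sqrt p with hk
  have hk₁ : p < (k + 1) * (k + 1) := Nat.lt_succ_sqrt p
  have hk₂ : k * k < p := by
    refine lt_of_le_of_ne (Nat.sqrt_le p) fun h => ?_
    have := hp
    rw [← h, ← sq] at this
    exact not_irreducible_pow (by norm_num) this
  obtain ⟨x, y, hxy, hf⟩ := Fintype.exists_ne_map_eq_of_card_lt
    (fun v : Fin (k + 1) × Fin (k + 1) => ((v.1 : ℕ) : ZMod p) + r * ((v.2 : ℕ) : ZMod p))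
    (by simpa [ZMod.card] using hk₁)
  obtain ⟨⟨x₁, hx₁⟩, ⟨x₂, hx₂⟩⟩ := x
  obtain ⟨⟨y₁, hy₁⟩, ⟨y₂, hy₂⟩⟩ := y
  simp only at hf
  set u : ℤ := (x₁ : ℤ) - y₁ with hu
  set v : ℤ := (x₂ : ℤ) - y₂ with hv
  have hdvd : (p : ℤ) ∣ u ^ 2 - u * v + v ^ 2 := by
    rw [← ZMod.intCast_zmod_eq_zero_iff_dvd]
    have huv : (u : ZMod p) = -r * v := by
      simp only [hu, hv]
      push_cast
      linear_combination hf
    push_cast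
    rw [huv]
    linear_combination (v : ZMod p) ^ 2 * hr
  have hne : u ≠ 0 ∨ v ≠ 0 := by
    by_contra! h
    apply hxy
    simp only [Prod.mk.injEq, Fin.mk.injEq]
    omega
  have hpos : 0 < u ^ 2 - u * v + v ^ 2 := by
    rcases hne with h | h
    · have := sq_pos_of_ne_zero h
      nlinarith [sq_nonneg (u - 2 * v)]
    · have := sq_pos_of_ne_zero h
      nlinarith [sq_nonneg (v - 2 * u)]
  have hub : u ^ 2 - u * v + v ^ 2 < 3 * p := by
    have hk₂' : (k : ℤ) * k < p := by exact_mod_cast hk₂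
    have h₁ : u ≤ k := by omega
    have h₂ : -k ≤ u := by omega
    have h₃ : v ≤ k := by omega
    have h₄ : -k ≤ v := by omega
    nlinarith [mul_nonneg (sub_nonneg.mpr h₁) (by linarith : 0 ≤ (k : ℤ) + u),
      mul_nonneg (sub_nonneg.mpr h₃) (by linarith : 0 ≤ (k : ℤ) + v),
      mul_nonneg (sub_nonneg.mpr h₁) (by linarith : 0 ≤ (k : ℤ) + v),
      mul_nonneg (sub_nonneg.mpr h₃) (by linarith : 0 ≤ (k : ℤ) + u)]
  have hN : u ^ 2 - u * v + v ^ 2 = p := by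
    obtain ⟨m, hm⟩ := hdvd
    have hp0 : (0 : ℤ) < p := by exact_mod_cast hp.pos
    have hm₁ : 0 < m := by
      rw [hm] at hpos
      exact pos_of_mul_pos_right hpos hp0.le
    have hm₂ : m < 3 := by
      rw [hm] at hub
      nlinarith
    interval_cases m
    · simpa using hm
    -- An even norm forces u and v even, hence is divisible by 4, while 2p is not.
    · exfalso
      have hpodd : Odd (p : ℤ) := by
        have := hp.odd_of_ne_two (by rintro rfl; norm_num at hp3)
        exact_mod_cast this
      obtain ⟨t, ht⟩ := hpodd
      rcases Int.even_or_odd' u with ⟨e, he | he⟩ <;> rcases Int.even_or_odd' v with ⟨f, hf | hf⟩ <;>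
        rw [he, hf, ht] at hm <;> ring_nf at hm <;> omega
  have hs : (u + v) % 3 = 1 ∨ (-u + -v) % 3 = 1 := by
    have hmod : (u + v) ^ 2 % 3 = 1 := by
      have : (u + v) ^ 2 = p + 3 * (u * v) := by linear_combination hN
      omega
    have : (u + v) % 3 = 0 ∨ (u + v) % 3 = 1 ∨ (u + v) % 3 = 2 := by omega
    rcases this with h | h | h
    · simp [pow_two, Int.mul_emod, h] at hmod
    · exact Or.inl h
    · right; omega
  rcases hs with hs | hs
  · exact ⟨u, v, hN, hs⟩
  · exact ⟨-u, -v, by simp only [eisNorm]; linear_combination hN, hs⟩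

/-! ### Fourier coefficients as lattice sums -/

open Function.Periodic (qParam)

/-- Uniqueness of power series for the cusp function at 0. The expansion itself supplies the
periodicity and the boundedness at infinity. -/
lemma qExpansion_coeff_eq_of_hasSum {f : ℂ → ℂ} (hf : DifferentiableOn ℂ f {z | 0 < z.im})
    {c : ℕ → ℂ} (h : ∀ τ : ℍ, HasSum (fun m => c m * qParam 1 τ ^ m) (f τ)) (m : ℕ) :
    (qExpansion 1 (fun τ : ℍ => f τ)).coeff m = c m := by
  have h' (τ : ℍ) : HasSum (fun m => c m • qParam 1 τ ^ m) (f τ) := h τ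
  have hper : Function.Periodic ((fun τ : ℍ => f τ) ∘ ofComplex) (1 : ℝ) := by
    intro z
    rcases lt_or_ge 0 z.im with hz | hz
    · have hz' : 0 < (z + (1 : ℝ)).im := by simpa using hz
      have h₁ := h ⟨z + (1 : ℝ), hz'⟩
      have h₂ := h ⟨z, hz⟩
      have hq : qParam 1 (z + (1 : ℝ)) = qParam 1 z := by
        simp [qParam, mul_add, Complex.exp_add]
      simp only [hq] at h₁
      simpa only [Function.comp, ofComplex_apply_of_im_pos hz, ofComplex_apply_of_im_pos hz']
        using h₁.unique h₂
    · have hz' : (z + (1 : ℝ)).im ≤ 0 := by simpa using hz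
      simp only [Function.comp, ofComplex_apply_eq_of_im_nonpos hz' hz]
  have hdiff := (UpperHalfPlane.mdifferentiable_iff (f := fun τ : ℍ => f τ)).mpr <|
      hf.congr fun z hz => by
    have hz' : 0 < z.im := hz
    simp [ofComplex_apply_of_im_pos hz']
  have hbdd : IsBoundedAtImInfty (fun τ : ℍ => f τ) :=
    isBoundedAtImInfty_of_hasSum_qExpansion one_pos h'
  have han := analyticAt_cuspFunction_zero one_pos hper hdiff hbdd
  have h₁ := (hasFPowerSeriesOnBall_cuspFunction one_pos han h').hasFPowerSeriesAt
  have h₂ := congrArg (FormalMultilinearSeries.coeff · m)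
    (han.hasFPowerSeriesAt.eq_formalMultilinearSeries h₁)
  simpa [qExpansion_coeff, div_eq_mul_inv, mul_comm] using h₂

lemma hasSum_eisNorm_fiber {F : ℤ × ℤ → ℂ} {Q S : ℂ}
    (h : HasSum (fun v => F v * Q ^ eisNorm v) S) :
    HasSum (fun n : ℕ => (∑' v : {v // eisNorm v = n}, F v) * Q ^ n) S := by
  have h₁ := (Equiv.sigmaFiberEquiv fun v : ℤ × ℤ => (eisNorm v).toNat).hasSum_iff.mpr h
  refine (h₁.sigma fun n => (h₁.summable.sigma_factor n).hasSum).of_eq (fun n => ?_) rfl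
  rw [← tsum_mul_right]
  have he (v : ℤ × ℤ) : eisNorm v = n ↔ (eisNorm v).toNat = n := by
    have := eisNorm_nonneg v
    omega
  rw [← (Equiv.subtypeEquivRight he).tsum_eq]
  refine tsum_congr fun v => ?_
  simp [Equiv.sigmaFiberEquiv, v.2]

lemma qExpansion_coeff_eq_tsum {f : ℂ → ℂ} (hf : DifferentiableOn ℂ f {z | 0 < z.im}) {κ : ℂ}
    (hκ : κ ≠ 0) {F : ℤ × ℤ → ℂ}
    (h : ∀ τ : ℍ, HasSum (fun v => F v * qParam 1 τ ^ eisNorm v) (κ * f τ)) (m : ℕ) :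
    κ * (qExpansion 1 (fun τ : ℍ => f τ)).coeff m = ∑' v : {v // eisNorm v = m}, F v := by
  rw [qExpansion_coeff_eq_of_hasSum hf
    (c := fun n => κ⁻¹ * ∑' v : {v // eisNorm v = n}, F v) fun τ => ?_, mul_inv_cancel_left₀ hκ]
  refine ((hasSum_eisNorm_fiber (h τ)).mul_left κ⁻¹).of_eq
    (fun n => by ring) ?_
  rw [inv_mul_cancel_left₀ hκ]

lemma eta_natCast_mul (k : ℕ) (z : ℂ) :
    eta (k * z) = qParam 24 (k * z) * eulerProd (qParam 1 z ^ k) := by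
  have h : qParam 1 (k * z) = qParam 1 z ^ k := by
    simp only [qParam, ← Complex.exp_nat_mul]
    congr 1
    ring
  simp only [eta, eulerProd, eta_q, h]

lemma differentiableOn_eta_natCast_mul {k : ℕ} (hk : 0 < k) :
    DifferentiableOn ℂ (fun z => eta (k * z)) {z | 0 < z.im} := by
  intro z hz
  refine DifferentiableAt.differentiableWithinAt ?_
  refine DifferentiableAt.comp z (differentiableAt_eta_of_mem_upperHalfPlaneSet ?_) (by fun_prop)
  have hz' : 0 < z.im := hz
  have hk' : (0 : ℝ) < k := by exact_mod_cast hk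
  simpa using mul_pos hk' hz'

lemma two_mul_aStar (m : ℕ) : 2 * aStar m = ∑' v : {v // eisNorm v = m},
    (signThree (v.1.1 + v.1.2) : ℂ) * ((v.1.1 : ℂ) ^ 2 * v.1.2) := by
  refine qExpansion_coeff_eq_tsum (f := fun z => eta (3 * z) ^ 8)
    (F := fun v => (signThree (v.1 + v.2) : ℂ) * ((v.1 : ℂ) ^ 2 * v.2))
    ((differentiableOn_eta_natCast_mul (k := 3) (by norm_num)).pow 8) two_ne_zero (fun τ => ?_) m
  refine (hasSum_eulerProd_pow_eight (Function.Periodic.norm_qParam_lt_one one_pos τ.im_pos)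
    (Function.Periodic.qParam_ne_zero _)).of_eq (fun _ => rfl) ?_
  have h₁ := eta_natCast_mul 3 τ
  -- The exponents of q^(1/24) add up to 3·8/24 = 1.
  have h₂ : qParam 24 (3 * τ) ^ 8 = qParam 1 τ := by
    simp only [qParam, ← Complex.exp_nat_mul]
    congr 1
    push_cast
    ring
  push_cast at h₁
  rw [h₁, mul_pow, h₂]

lemma neg_three_mul_cStar {w : ℂ} (hw : w ^ 2 + w + 1 = 0) (m : ℕ) :
    -3 * cStar m = ∑' v : {v // eisNorm v = m},
      (signThree (v.1.1 + v.1.2) : ℂ) * ((v.1.1 : ℂ) * w ^ v.1.2) := by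
  refine qExpansion_coeff_eq_tsum (f := fun z => eta (3 * z) ^ 2 * eta (9 * z) ^ 2)
    (F := fun v => (signThree (v.1 + v.2) : ℂ) * ((v.1 : ℂ) * w ^ v.2))
    (((differentiableOn_eta_natCast_mul (k := 3) (by norm_num)).pow 2).mul
      ((differentiableOn_eta_natCast_mul (k := 9) (by norm_num)).pow 2)) (by norm_num)
    (fun τ => ?_) m
  refine (hasSum_eulerProd_sq_mul_sq (Function.Periodic.norm_qParam_lt_one one_pos τ.im_pos)
    (Function.Periodic.qParam_ne_zero _) hw).of_eq (fun _ => rfl) ?_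
  have h₁ := eta_natCast_mul 3 τ
  have h₂ := eta_natCast_mul 9 τ
  have h₃ : qParam 24 (3 * τ) ^ 2 * qParam 24 (9 * τ) ^ 2 = qParam 1 τ := by
    simp only [qParam, ← Complex.exp_nat_mul, ← Complex.exp_add]
    congr 1
    push_cast
    ring
  push_cast at h₁ h₂
  rw [h₁, h₂, ← h₃]
  ring

/-! ### Evaluation at primes -/

lemma aStar_eq {p : ℕ} (hp : p.Prime) {a b : ℤ} (hab : eisNorm (a, b) = p)
    (hs : (a + b) % 3 = 1) :
    aStar p = ((a + b) * (a - 2 * b) * (2 * a - b) : ℤ) := by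
  have h := two_mul_aStar p
  rw [tsum_eisNorm_fiber (Nat.prime_iff_prime_int.mp hp) hab hs
    (fun v => (signThree (v.1 + v.2) : ℂ) * ((v.1 : ℂ) ^ 2 * v.2))] at h
  have hneg {s : ℤ} (h : s % 3 = 1) : signThree s = -1 := by simp [signThree, h]
  have hpos {s : ℤ} (h : s % 3 = 2) : signThree s = 1 := by simp [signThree, h]
  simp only [eisAssociates, List.map_cons, List.map_nil, List.sum_cons, List.sum_nil] at h
  rw [hneg hs, hneg (s := -b + (a - b)) (by omega), hneg (s := b - a + -a) (by omega),
    hneg (s := a - b + -b) (by omega), hneg (s := -a + (b - a)) (by omega),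
    hneg (s := b + a) (by omega), hpos (s := -a + -b) (by omega),
    hpos (s := b + (b - a)) (by omega), hpos (s := a - b + a) (by omega),
    hpos (s := b - a + b) (by omega), hpos (s := a + (a - b)) (by omega),
    hpos (s := -b + -a) (by omega)] at h
  push_cast at h ⊢
  linear_combination h / 2

lemma cStar_eq {p : ℕ} (hp : p.Prime) {a b : ℤ} (hab : eisNorm (a, b) = p)
    (ha : a % 3 = 1) (hb : b % 3 = 0) : cStar p = (2 * a - b : ℤ) := by
  -- w = (-1 + √-3)/2. The congruences on a and b then determine each power of w in the twelve
  -- terms.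
  obtain ⟨w, hw⟩ : ∃ w : ℂ, w ^ 2 + w + 1 = 0 := by
    obtain ⟨z, hz⟩ := IsAlgClosed.exists_pow_nat_eq (-3 : ℂ) two_pos
    exact ⟨(z - 1) / 2, by linear_combination hz / 4⟩
  have hw0 : w ≠ 0 := by rintro rfl; simp at hw
  have hw3 : w ^ 3 = 1 := by linear_combination (w - 1) * hw
  have hwz (n : ℤ) : w ^ (3 * n) = 1 := by
    rw [zpow_mul]
    norm_cast
    rw [hw3, one_zpow]
  have hw₀ {n : ℤ} (h : n % 3 = 0) : w ^ n = 1 := by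
    rw [← Int.emod_add_mul_ediv n 3, h, zero_add, hwz]
  have hw₁ {n : ℤ} (h : n % 3 = 1) : w ^ n = w := by
    rw [← Int.emod_add_mul_ediv n 3, h, zpow_add₀ hw0, hwz, zpow_one, mul_one]
  have hw₂ {n : ℤ} (h : n % 3 = 2) : w ^ n = w ^ 2 := by
    rw [← Int.emod_add_mul_ediv n 3, h, zpow_add₀ hw0, hwz, mul_one]
    rfl
  have h := neg_three_mul_cStar hw p
  rw [tsum_eisNorm_fiber (Nat.prime_iff_prime_int.mp hp) hab (by omega)
    (fun v => (signThree (v.1 + v.2) : ℂ) * ((v.1 : ℂ) * w ^ v.2))] at h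
  have hneg {s : ℤ} (h : s % 3 = 1) : signThree s = -1 := by simp [signThree, h]
  have hpos {s : ℤ} (h : s % 3 = 2) : signThree s = 1 := by simp [signThree, h]
  simp only [eisAssociates, List.map_cons, List.map_nil, List.sum_cons, List.sum_nil] at h
  rw [hneg (s := a + b) (by omega), hneg (s := -b + (a - b)) (by omega),
    hneg (s := b - a + -a) (by omega),
    hneg (s := a - b + -b) (by omega), hneg (s := -a + (b - a)) (by omega),
    hneg (s := b + a) (by omega), hpos (s := -a + -b) (by omega),
    hpos (s := b + (b - a)) (by omega), hpos (s := a - b + a) (by omega),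
    hpos (s := b - a + b) (by omega), hpos (s := a + (a - b)) (by omega),
    hpos (s := -b + -a) (by omega), hw₀ hb, hw₁ (n := a - b) (by omega),
    hw₂ (n := -a) (by omega), hw₀ (n := -b) (by omega), hw₂ (n := b - a) (by omega),
    hw₁ ha] at h
  push_cast at h ⊢
  linear_combination -h / 3 - (2 * a - b : ℂ) / 3 * hw

theorem mainTheorem3 (p : ℕ) (hp : p.Prime) (hp3 : p ≡ 1 [MOD 3]) :
    ∃ a c : ℤ, aStar p = (a : ℂ) ∧ cStar p = (c : ℂ) ∧
      c ∣ a ∧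
      (∃ x y : ℤ, (p : ℤ) = x ^ 2 + 3 * y ^ 2 ∧ x ≡ 1 [ZMOD 3]) ∧
      (∀ x y : ℤ, (p : ℤ) = x ^ 2 + 3 * y ^ 2 → x ≡ 1 [ZMOD 3] →
        a = 2 * x ^ 3 - 18 * x * y ^ 2) ∧
      (∃ m n : ℤ, (p : ℤ) = m ^ 2 + m * n + n ^ 2 ∧ m ≡ 1 [ZMOD 3] ∧ n ≡ 0 [ZMOD 3]) ∧
      (∀ m n : ℤ, (p : ℤ) = m ^ 2 + m * n + n ^ 2 → m ≡ 1 [ZMOD 3] → n ≡ 0 [ZMOD 3] →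
        c = 2 * m + n ∧ a = (2 * m + n) * (m + 2 * n) * (m - n)) := by
  obtain ⟨u, v, huv, hs⟩ := exists_eisNorm_eq hp hp3
  simp only [Int.ModEq]
  have huv' : u ^ 2 - u * v + v ^ 2 = p := huv
  obtain ⟨a, b, hab, ha, hb⟩ : ∃ a b : ℤ, eisNorm (a, b) = p ∧ a % 3 = 1 ∧ b % 3 = 0 := by
    simp only [eisNorm]
    -- Passing to an associate or conjugate moves the coordinate divisible by 3 into second place.
    have : v % 3 = 0 ∨ v % 3 = 1 ∨ v % 3 = 2 := by omega
    rcases this with h | h | h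
    · exact ⟨u, v, huv, by omega, h⟩
    · exact ⟨v, u, by linear_combination huv', h, by omega⟩
    · exact ⟨-v, u - v, by linear_combination huv', by omega, by omega⟩
  have hab' : a ^ 2 - a * b + b ^ 2 = p := hab
  have hA := aStar_eq hp hab (by omega)
  have hC := cStar_eq hp hab ha hb
  refine ⟨_, _, hA, hC, ⟨(a + b) * (a - 2 * b), by ring⟩, ?_, fun x y hxy hx => ?_, ?_,
    fun m n hmn hm hn => ⟨?_, ?_⟩⟩
  -- Some associate or conjugate has even second coordinate 2y, and the norm of (x + y, 2y) is x² +
  -- 3y².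
  · have : v % 2 = 0 ∨ u % 2 = 0 ∨ (u - v) % 2 = 0 := by omega
    rcases this with h | h | h
    · obtain ⟨y, rfl⟩ := Int.dvd_of_emod_eq_zero h
      exact ⟨u - y, y, by linear_combination -huv', by omega⟩
    · obtain ⟨y, rfl⟩ := Int.dvd_of_emod_eq_zero h
      exact ⟨v - y, y, by linear_combination -huv', by omega⟩
    · obtain ⟨y, hy⟩ := Int.dvd_of_emod_eq_zero h
      obtain rfl : u = 2 * y + v := by omega
      exact ⟨-v - y, y, by linear_combination -huv', by omega⟩
  -- x + y√-3 = (x + y) + 2yω.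
  · have h := aStar_eq hp (a := x + y) (b := 2 * y)
      (by simp only [eisNorm]; linear_combination -hxy) (by omega)
    have := Int.cast_injective (hA.symm.trans h)
    linear_combination this
  · exact ⟨a, -b, by linear_combination -hab', ha, by omega⟩
  · have h := cStar_eq hp (a := m) (b := -n)
      (by simp only [eisNorm]; linear_combination -hmn) hm (by omega)
    have := Int.cast_injective (hC.symm.trans h)
    linear_combination this
  · have h := aStar_eq hp (a := m) (b := -n)
      (by simp only [eisNorm]; linear_combination -hmn) (by omega)
    have := Int.cast_injective (hA.symm.trans h)
    linear_combination this
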